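/- A polymatroid on a finite set $M$ is a function $f:2^M\to\mathbb R$ with $f(\emptyset)=0$ that is non-negative, monotone ($f(A)\le f(B)$ for $A\subseteq B$) and submodular ($f(A\cup B)+f(A\cap B)\le f(A)+f(B)$). For disjoint $I,J,K\subseteq M$ write $f(I|K)=f(I\cup K)-f(K)$ and $f(I,J|K)=f(I\cup K)+f(J\cup K)-f(I\cup J\cup K)-f(K)$; braces and union signs are omitted, so that, for instance, $f(a|bc)=f(\{a,b,c\})-f(\{b,c\})$. A polymatroid $f$ on $M$ is called $1$-sticky if, for all finite sets $X,Y$ with $M,X,Y$ pairwise disjoint and $|X|\le 1$, $|Y|\le 1$, any two polymatroids $f_X$ on $M\cup X$ and $f_Y$ on $M\cup Y$ whose restrictions to $M$ are both $f$ have an amalgam, that is, there is a polymatroid on $M\cup X\cup Y$ whose restrictions to $M\cup X$ and $M\cup Y$ are $f_X$ and $f_Y$, respectively. Let $f$ be a polymatroid on a three-element set $\{a,b,c\}$ such that $f(a|bc)=f(b|ac)=f(c|ab)=0$, and suppose that at least one of $f(a,b|c)$, $f(a,c|b)$, $f(b,c|a)$ is zero. Then $f$ is $1$-sticky. -/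

import Mathlib

universe u v w

/-- A polymatroid on the finite ground set `M`: a real-valued rank function on the subsets of `M`
which vanishes at the empty set and is monotone and submodular
(non-negativity follows, see `Polymatroid.nonneg`). -/
structure Polymatroid (M : Type*) [Finite M] where
  /-- The rank of a subset of the ground set. -/
  rank : Set M → ℝ
  rank_empty : rank ∅ = 0
  mono : ∀ A B : Set M, A ⊆ B → rank A ≤ rank B
  submodular : ∀ A B : Set M, rank (A ∪ B) + rank (A ∩ B) ≤ rank A + rank B

namespace Polymatroid

theorem nonneg {M : Type*} [Finite M] (f : Polymatroid M) (A : Set M) : 0 ≤ f.rank A := by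
  have h := f.mono ∅ A (Set.empty_subset A)
  rwa [f.rank_empty] at h

/-- The conditional rank `f(I|K) = f(IK) - f(K)`. -/
def condRank {M : Type*} [Finite M] (f : Polymatroid M) (I K : Set M) : ℝ :=
  f.rank (I ∪ K) - f.rank K

/-- The expression `f(I,J|K) = f(IK) + f(JK) - f(IJK) - f(K)`. -/
def condInfo {M : Type*} [Finite M] (f : Polymatroid M) (I J K : Set M) : ℝ :=
  f.rank (I ∪ K) + f.rank (J ∪ K) - f.rank (I ∪ J ∪ K) - f.rank K

/-- The polymatroid `g` on the disjoint union of `M` and `X` is an extension of `f` on `M`. -/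
def IsExtension {M X : Type*} [Finite M] [Finite X]
    (g : Polymatroid (M ⊕ X)) (f : Polymatroid M) : Prop :=
  ∀ A : Set M, g.rank (Sum.inl '' A) = f.rank A

/-- The polymatroids `fX` on `M ∪ X` and `fY` on `M ∪ Y` (with `M`, `X`, `Y` disjoint) have an
amalgam: some polymatroid on `M ∪ X ∪ Y` extends both of them. -/
def HaveAmalgam {M X Y : Type*} [Finite M] [Finite X] [Finite Y]
    (fX : Polymatroid (M ⊕ X)) (fY : Polymatroid (M ⊕ Y)) : Prop :=
  ∃ g : Polymatroid (M ⊕ (X ⊕ Y)),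
    (∀ A : Set (M ⊕ X), g.rank (Sum.map id Sum.inl '' A) = fX.rank A) ∧
    (∀ A : Set (M ⊕ Y), g.rank (Sum.map id Sum.inr '' A) = fY.rank A)

/-- `f` is `k`-`l`-sticky: any two extensions of `f` by at most `k` and at most `l` new elements,
respectively, have an amalgam. -/
def IsStickyPair {M : Type u} [Finite M] (f : Polymatroid M) (k l : ℕ) : Prop :=
  ∀ (X : Type v) (Y : Type w) [Finite X] [Finite Y], Nat.card X ≤ k → Nat.card Y ≤ l →
    ∀ (fX : Polymatroid (M ⊕ X)) (fY : Polymatroid (M ⊕ Y)),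
      fX.IsExtension f → fY.IsExtension f → fX.HaveAmalgam fY

/-- `f` is `k`-sticky if it is `k`-`k`-sticky. -/
def IsSticky {M : Type u} [Finite M] (f : Polymatroid M) (k : ℕ) : Prop :=
  IsStickyPair.{u, v, w} f k k

end Polymatroid

/-! The three conditional ranks vanish, so every pair has full rank; a vanishing `condInfo` then
gives the remaining singleton, say `{c}`, full rank too. Thus `c` and `{a, b}` span each other, and
this persists in every extension, so a one-point extension is determined by its values on subsets of
`{a, b, x}`. It remains to amalgamate over the two-element set `{a, b}`, which is always possible
with explicit values (`exists_amalgam_values`), and to pull the result back along the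
join-preserving map that replaces `c` by `{a, b}` (`ofLattice`). -/

namespace Polymatroid

/-- Pull back a monotone submodular function along a join-preserving map from the subsets of `M`
to a lattice. -/
def ofLattice {M L : Type*} [Finite M] [Lattice L] [OrderBot L] (h : L → ℝ)
    (bot : h ⊥ = 0) (mono : Monotone h)
    (submod : ∀ p q, h (p ⊔ q) + h (p ⊓ q) ≤ h p + h q)
    (φ : Set M → L) (φ_empty : φ ∅ = ⊥) (φ_union : ∀ A B, φ (A ∪ B) = φ A ⊔ φ B) :
    Polymatroid M where
  rank A := h (φ A)
  rank_empty := by rw [φ_empty, bot]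
  mono A B hAB := by
    refine mono ?_
    rw [← Set.union_eq_self_of_subset_left hAB, φ_union]
    exact le_sup_left
  submodular A B := by
    have φ_mono : ∀ C D : Set M, C ⊆ D → φ C ≤ φ D := fun C D hCD => by
      rw [← Set.union_eq_self_of_subset_left hCD, φ_union]
      exact le_sup_left
    -- Intersections need not go to meets; the inequality plus monotonicity suffices.
    have h₁ : h (φ (A ∩ B)) ≤ h (φ A ⊓ φ B) :=
      mono (le_inf (φ_mono _ _ Set.inter_subset_left) (φ_mono _ _ Set.inter_subset_right))
    have h₂ := submod (φ A) (φ B)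
    rw [φ_union]
    linarith

/-! ### Amalgams over a two-element set -/

set_option linter.unusedVariables false in
/-- The values of an amalgam on the sets containing both new elements, for a two-element ground
set. The suffixes `o`, `a`, `b`, `t` stand for the subsets `∅`, `{a}`, `{b}`, `{a, b}`. -/
theorem exists_amalgam_values {fa fb ft xo xa xb xt yo ya yb yt : ℝ}
    (hfa : 0 ≤ fa) (hfb : 0 ≤ fb) (hfat : fa ≤ ft) (hfbt : fb ≤ ft)
    (hxo : 0 ≤ xo) (hyo : 0 ≤ yo)
    (hxa : fa ≤ xa) (hya : fa ≤ ya) (hxb : fb ≤ xb) (hyb : fb ≤ yb)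
    (hxt : ft ≤ xt) (hyt : ft ≤ yt)
    (hxat : xa ≤ xt) (hyat : ya ≤ yt) (hxbt : xb ≤ xt) (hybt : yb ≤ yt)
    (hxa' : xa ≤ xo + fa) (hya' : ya ≤ yo + fa)
    (hxb' : xb ≤ xo + fb) (hyb' : yb ≤ yo + fb)
    (hxat' : xt + fa ≤ xa + ft) (hyat' : yt + fa ≤ ya + ft)
    (hxbt' : xt + fb ≤ xb + ft) (hybt' : yt + fb ≤ yb + ft)
    (hx : xt + xo ≤ xa + xb) (hy : yt + yo ≤ ya + yb) :
    ∃ go ga gb gt : ℝ, xt ≤ gt ∧ yt ≤ gt ∧ ga ≤ gt ∧ gb ≤ gt ∧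
      go ≤ xo + yo ∧ ga + fa ≤ xa + ya ∧ gb + fb ≤ xb + yb ∧ gt + ft ≤ xt + yt ∧
      gt + go ≤ ga + gb ∧
      ga + yo ≤ ya + go ∧ gt + yb ≤ yt + gb ∧ ga + xo ≤ xa + go ∧ gt + xb ≤ xt + gb ∧
      gb + yo ≤ yb + go ∧ gt + ya ≤ yt + ga ∧ gb + xo ≤ xb + go ∧ gt + xa ≤ xt + ga := by
  -- Greedy choice from the top: `T` is the least possible top value. Submodularity bounds the
  -- increments below it by `pa`, `pb` (up to the top) and `qa`, `qb` (up from the bottom); take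
  -- `ga` and `gb`, then `go`, as small as these bounds allow.
  obtain ⟨T, hT₁, hT₂, hT⟩ : ∃ T, xt ≤ T ∧ yt ≤ T ∧ (T = xt ∨ T = yt) :=
    ⟨max xt yt, le_max_left _ _, le_max_right _ _, max_choice _ _⟩
  have hmin : ∀ r s : ℝ, ∃ m, m ≤ r ∧ m ≤ s ∧ (m = r ∨ m = s) := fun r s =>
    ⟨min r s, min_le_left _ _, min_le_right _ _, min_choice _ _⟩
  obtain ⟨pa, hpa₁, hpa₂, hpa⟩ := hmin (xt - xa) (yt - ya)
  obtain ⟨pb, hpb₁, hpb₂, hpb⟩ := hmin (xt - xb) (yt - yb)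
  obtain ⟨qa, hqa₁, hqa₂, hqa⟩ := hmin (xa - xo) (ya - yo)
  obtain ⟨qb, hqb₁, hqb₂, hqb⟩ := hmin (xb - xo) (yb - yo)
  have hpa₀ : 0 ≤ pa := by rcases hpa with h | h <;> linarith
  have hpb₀ : 0 ≤ pb := by rcases hpb with h | h <;> linarith
  -- From `hx` and `hy`; with `hpqb` this yields `gt + go ≤ ga + gb`.
  have hpqa : pb ≤ qa := by rcases hqa with h | h <;> linarith
  have hpqb : pa ≤ qb := by rcases hqb with h | h <;> linarith
  have hTt : T + ft ≤ xt + yt := by rcases hT with h | h <;> linarith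
  have hua : T - pa + fa ≤ xa + ya := by
    rcases hT with h | h <;> rcases hpa with h' | h' <;> linarith
  have hub : T - pb + fb ≤ xb + yb := by
    rcases hT with h | h <;> rcases hpb with h' | h' <;> linarith
  have hoa : T - pa - qa ≤ xo + yo := by
    rcases hT with h | h <;> rcases hpa with h' | h' <;> rcases hqa with h'' | h'' <;> linarith
  have hob : T - pb - qb ≤ xo + yo := by
    rcases hT with h | h <;> rcases hpb with h' | h' <;> rcases hqb with h'' | h'' <;> linarith
  obtain ⟨go, hgo₁, hgo₂, hgo⟩ : ∃ go, T - pa - qa ≤ go ∧ T - pb - qb ≤ go ∧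
      (go = T - pa - qa ∨ go = T - pb - qb) :=
    ⟨max _ _, le_max_left _ _, le_max_right _ _, max_choice _ _⟩
  have hgo₃ : go ≤ xo + yo := by rcases hgo with h | h <;> linarith
  have hgo₄ : go ≤ T - pa - pb := by rcases hgo with h | h <;> linarith
  refine ⟨go, T - pa, T - pb, T, ?_, ?_, ?_, ?_, ?_, ?_, ?_, ?_, ?_, ?_, ?_, ?_, ?_, ?_, ?_, ?_,
    ?_⟩ <;> linarith

set_option maxHeartbeats 4000000 in
/-- Two polymatroid rank functions on a three-element set, presented on the lattice of subsets,
which agree on a two-element subset have an amalgam. -/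
theorem exists_amalgam_bool (hX hY : Bool × Bool × Bool → ℝ)
    (hX_bot : hX ⊥ = 0) (hX_mono : Monotone hX) (hY_mono : Monotone hY)
    (hX_sub : ∀ p q, hX (p ⊔ q) + hX (p ⊓ q) ≤ hX p + hX q)
    (hY_sub : ∀ p q, hY (p ⊔ q) + hY (p ⊓ q) ≤ hY p + hY q)
    (hXY : ∀ i j, hX (i, j, false) = hY (i, j, false)) :
    ∃ h : Bool × Bool × Bool × Bool → ℝ, Monotone h ∧
      (∀ p q, h (p ⊔ q) + h (p ⊓ q) ≤ h p + h q) ∧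
      (∀ i j s, h (i, j, s, false) = hX (i, j, s)) ∧
      (∀ i j t, h (i, j, false, t) = hY (i, j, t)) := by
  have mX : ∀ i j s i' j' s', i ≤ i' → j ≤ j' → s ≤ s' → hX (i, j, s) ≤ hX (i', j', s') :=
    fun i j s i' j' s' h₁ h₂ h₃ => hX_mono ⟨h₁, h₂, h₃⟩
  have mY : ∀ i j s i' j' s', i ≤ i' → j ≤ j' → s ≤ s' → hY (i, j, s) ≤ hY (i', j', s') :=
    fun i j s i' j' s' h₁ h₂ h₃ => hY_mono ⟨h₁, h₂, h₃⟩
  have sX := fun i j s i' j' s' => hX_sub (i, j, s) (i', j', s')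
  have sY := fun i j s i' j' s' => hY_sub (i, j, s) (i', j', s')
  simp only [Prod.mk_sup_mk, Prod.mk_inf_mk] at sX sY
  have eo := hXY false false
  have ea := hXY true false
  have eb := hXY false true
  have et := hXY true true
  have hX_bot' : hX (false, false, false) = 0 := hX_bot
  have mXo := mX false false false false false true le_rfl le_rfl (by decide)
  have mYo := mY false false false false false true le_rfl le_rfl (by decide)
  have mFa := mX false false false true false false (by decide) le_rfl le_rfl
  have mFb := mX false false false false true false le_rfl (by decide) le_rfl
  have mFat := mX true false false true true false le_rfl (by decide) le_rfl
  have mFbt := mX false true false true true false (by decide) le_rfl le_rfl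
  have mXa := mX true false false true false true le_rfl le_rfl (by decide)
  have mYa := mY true false false true false true le_rfl le_rfl (by decide)
  have mXb := mX false true false false true true le_rfl le_rfl (by decide)
  have mYb := mY false true false false true true le_rfl le_rfl (by decide)
  have mXt := mX true true false true true true le_rfl le_rfl (by decide)
  have mYt := mY true true false true true true le_rfl le_rfl (by decide)
  have mXat := mX true false true true true true le_rfl (by decide) le_rfl
  have mYat := mY true false true true true true le_rfl (by decide) le_rfl
  have mXbt := mX false true true true true true (by decide) le_rfl le_rfl
  have mYbt := mY false true true true true true (by decide) le_rfl le_rfl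
  have mXoa := mX false false true true false true (by decide) le_rfl le_rfl
  have mYoa := mY false false true true false true (by decide) le_rfl le_rfl
  have mXob := mX false false true false true true le_rfl (by decide) le_rfl
  have mYob := mY false false true false true true le_rfl (by decide) le_rfl
  have sF := sX true false false false true false
  have sXoa := sX false false true true false false
  have sYoa := sY false false true true false false
  have sXob := sX false false true false true false
  have sYob := sY false false true false true false
  have sXat := sX true false true true true false
  have sYat := sY true false true true true false
  have sXbt := sX false true true true true false
  have sYbt := sY false true true true true false
  have sXt := sX true false true false true true
  have sYt := sY true false true false true true
  simp only [Bool.sup_eq_bor, Bool.inf_eq_band, Bool.or_false, Bool.or_true, Bool.and_false,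
    Bool.and_true, hX_bot'] at *
  obtain ⟨go, ga, gb, gt, h₁, h₂, h₃, h₄, h₅, h₆, h₇, h₈, h₉, h₁₀, h₁₁, h₁₂, h₁₃, h₁₄, h₁₅,
    h₁₆, h₁₇⟩ := exists_amalgam_values (fa := hY (true, false, false))
      (fb := hY (false, true, false)) (ft := hY (true, true, false))
      (xo := hX (false, false, true)) (xa := hX (true, false, true))
      (xb := hX (false, true, true)) (xt := hX (true, true, true))
      (yo := hY (false, false, true)) (ya := hY (true, false, true))
      (yb := hY (false, true, true)) (yt := hY (true, true, true))
      (by linarith) (by linarith) (by linarith) (by linarith) (by linarith) (by linarith)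
      (by linarith) (by linarith) (by linarith) (by linarith) (by linarith) (by linarith)
      (by linarith) (by linarith) (by linarith) (by linarith) (by linarith) (by linarith)
      (by linarith) (by linarith) (by linarith) (by linarith) (by linarith) (by linarith)
      (by linarith) (by linarith)
  clear mX mY sX sY hX_mono hY_mono hX_sub hY_sub
  -- The coordinates record `a`, `b`, `x`, `y`; only sets containing both `x` and `y` get new
  -- values.
  let h : Bool × Bool × Bool × Bool → ℝ
    | (i, j, false, t) => hY (i, j, t)
    | (i, j, true, false) => hX (i, j, true)
    | (false, false, true, true) => go
    | (true, false, true, true) => ga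
    | (false, true, true, true) => gb
    | (true, true, true, true) => gt
  refine ⟨h, ?_, ?_, ?_, fun i j t => rfl⟩
  · rintro ⟨i, j, s, t⟩ ⟨i', j', s', t'⟩ ⟨(hi : i ≤ i'), (hj : j ≤ j'), (hs : s ≤ s'),
      (ht : t ≤ t')⟩
    cases i <;> cases i' <;> first | exact absurd hi (by decide) | skip
    all_goals cases j <;> cases j' <;> first | exact absurd hj (by decide) | skip
    all_goals cases s <;> cases s' <;> first | exact absurd hs (by decide) | skip
    all_goals cases t <;> cases t' <;> first | exact absurd ht (by decide) | skip
    all_goals simp only [h]; linarith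
  · rintro ⟨i, j, s, t⟩ ⟨i', j', s', t'⟩
    simp only [Prod.mk_sup_mk, Prod.mk_inf_mk]
    cases i <;> cases i' <;> cases j <;> cases j' <;> cases s <;> cases s' <;> cases t <;>
      cases t' <;> simp only [h, Bool.sup_eq_bor, Bool.inf_eq_band, Bool.or_false, Bool.or_true,
        Bool.and_false, Bool.and_true] <;> linarith
  · rintro i j (_ | _)
    · exact (hXY i j).symm
    · rfl

/-! ### Reduction to two elements -/

/-- Adjoining to `A` a set of old elements which lies in the closure of `A` does not change the
rank in an extension. -/
theorem IsExtension.rank_union {M X : Type*} [Finite M] [Finite X] {g : Polymatroid (M ⊕ X)}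
    {f : Polymatroid M} (hg : g.IsExtension f) (A : Set (M ⊕ X)) (C : Set M)
    (hC : f.rank (Sum.inl ⁻¹' A ∪ C) = f.rank (Sum.inl ⁻¹' A)) :
    g.rank (A ∪ Sum.inl '' C) = g.rank A := by
  -- The two sets meet exactly in the old part of `A`, whose rank equals that of the second set.
  have h := g.submodular A (Sum.inl '' (Sum.inl ⁻¹' A ∪ C))
  have h₁ : A ∪ Sum.inl '' (Sum.inl ⁻¹' A ∪ C) = A ∪ Sum.inl '' C := by
    ext z
    simp only [Set.mem_union, Set.mem_image, Set.mem_preimage]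
    aesop
  have h₂ : A ∩ Sum.inl '' (Sum.inl ⁻¹' A ∪ C) = Sum.inl '' (Sum.inl ⁻¹' A) := by
    ext z
    simp only [Set.mem_union, Set.mem_inter_iff, Set.mem_image, Set.mem_preimage]
    aesop
  rw [h₁, h₂, hg, hg, hC] at h
  have := g.mono A _ (Set.subset_union_left (t := Sum.inl '' C))
  linarith

open Classical in
/-- If the subset `{a, b}` of `{a, b, c}` and the element `c` both have full rank, then any
extension by at most one element `x` is determined by its values on the subsets of
`{a, b, x}`. -/
theorem IsExtension.exists_bool {M X : Type*} [Finite M] [Finite X] [Subsingleton X] {a b c : M}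
    (hab : a ≠ b) (hM : (Set.univ : Set M) = {a, b, c}) {g : Polymatroid (M ⊕ X)}
    {f : Polymatroid M} (hg : g.IsExtension f)
    (hab_rank : f.rank {a, b} = f.rank Set.univ) (hc_rank : f.rank {c} = f.rank Set.univ) :
    ∃ h : Bool × Bool × Bool → ℝ, h ⊥ = 0 ∧ Monotone h ∧
      (∀ p q, h (p ⊔ q) + h (p ⊓ q) ≤ h p + h q) ∧
      (∀ i j, h (i, j, false) = f.rank {m | (m = a ∧ i) ∨ (m = b ∧ j)}) ∧
      ∀ A, g.rank A = h (decide (Sum.inl a ∈ A ∨ Sum.inl c ∈ A),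
        decide (Sum.inl b ∈ A ∨ Sum.inl c ∈ A), decide (∃ x, Sum.inr x ∈ A)) := by
  have hM' : ∀ m : M, m = a ∨ m = b ∨ m = c := fun m => by
    have : m ∈ (Set.univ : Set M) := trivial
    rwa [hM] at this
  let ψ : Bool × Bool → Set M := fun p => {m | (m = a ∧ p.1) ∨ (m = b ∧ p.2)}
  let φ : Set M → Bool × Bool := fun A => (decide (a ∈ A ∨ c ∈ A), decide (b ∈ A ∨ c ∈ A))
  let ψX : Bool × Bool × Bool → Set (M ⊕ X) := fun p =>
    {z | (z = Sum.inl a ∧ p.1) ∨ (z = Sum.inl b ∧ p.2.1) ∨ (z.isRight ∧ p.2.2)}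
  -- `ψ (φ A)` is `A` with `c` traded for `{a, b}`; if `c ∈ A`, all sets involved have full rank.
  have closure_rank : ∀ A : Set M, f.rank (A ∪ ψ (φ A)) = f.rank A ∧
      f.rank (A ∪ ψ (φ A)) = f.rank (ψ (φ A)) := by
    intro A
    by_cases hcA : c ∈ A
    · have hψ : ψ (φ A) = {a, b} := by
        ext m
        simp [ψ, φ, hcA]
      have h₁ := f.mono {c} A (by simpa using hcA)
      have h₂ := f.mono A (A ∪ ψ (φ A)) Set.subset_union_left
      have h₃ := f.mono (A ∪ ψ (φ A)) _ (Set.subset_univ _)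
      have h₄ := f.mono (ψ (φ A)) (A ∪ ψ (φ A)) Set.subset_union_right
      rw [hψ] at *
      constructor <;> linarith
    · have hψ : ψ (φ A) = A := by
        ext m
        simp only [ψ, φ, hcA, or_false, Set.mem_ofPred_eq, decide_eq_true_eq]
        constructor
        · rintro (⟨rfl, h⟩ | ⟨rfl, h⟩) <;> exact h
        · intro hm
          rcases hM' m with rfl | rfl | rfl
          · exact Or.inl ⟨rfl, hm⟩
          · exact Or.inr ⟨rfl, hm⟩
          · exact absurd hm hcA
      simp [hψ]
  refine ⟨fun p => g.rank (ψX p), ?_, ?_, ?_, ?_, ?_⟩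
  · have : ψX ⊥ = ∅ := by
      ext z
      simp [ψX]
    simp only [this, g.rank_empty]
  · rintro ⟨i, j, s⟩ ⟨i', j', s'⟩ ⟨(hi : i ≤ i'), (hj : j ≤ j'), (hs : s ≤ s')⟩
    refine g.mono _ _ ?_
    rintro z (⟨rfl, h⟩ | ⟨rfl, h⟩ | ⟨hz, h⟩)
    · exact Or.inl ⟨rfl, hi h⟩
    · exact Or.inr (Or.inl ⟨rfl, hj h⟩)
    · exact Or.inr (Or.inr ⟨hz, hs h⟩)
  · rintro ⟨i, j, s⟩ ⟨i', j', s'⟩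
    have h₁ : ψX ((i, j, s) ⊔ (i', j', s')) = ψX (i, j, s) ∪ ψX (i', j', s') := by
      ext z
      simp only [ψX, Prod.mk_sup_mk, Bool.sup_eq_bor, Bool.or_eq_true, Set.mem_ofPred_eq,
        Set.mem_union]
      tauto
    have h₂ : ψX ((i, j, s) ⊓ (i', j', s')) = ψX (i, j, s) ∩ ψX (i', j', s') := by
      ext z
      simp only [ψX, Prod.mk_inf_mk, Bool.inf_eq_band, Bool.and_eq_true, Set.mem_ofPred_eq,
        Set.mem_inter_iff]
      rcases z with z | z
      · simp only [Sum.inl.injEq, Sum.isRight_inl, Bool.false_eq_true, false_and, or_false]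
        by_cases hza : z = a
        · subst hza
          simp [hab]
        · simp [hza]
          tauto
      · simp
    simp only [h₁, h₂]
    exact g.submodular _ _
  · intro i j
    rw [← hg]
    refine congrArg g.rank ?_
    ext (z | z) <;> simp [ψX]
  · intro A
    obtain ⟨h₁, h₂⟩ := closure_rank (Sum.inl ⁻¹' A)
    set p := φ (Sum.inl ⁻¹' A)
    have hψX : Sum.inl ⁻¹' ψX (p.1, p.2, decide (∃ x, Sum.inr x ∈ A)) = ψ p := by
      ext z
      simp [ψX, ψ]
    -- `A` and its representative are compared through their union, which has the rank of each.
    have h₃ := hg.rank_union A (ψ p) h₁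
    have h₄ := hg.rank_union (ψX (p.1, p.2, decide (∃ x, Sum.inr x ∈ A))) (Sum.inl ⁻¹' A)
      (by rw [hψX, Set.union_comm, h₂])
    have h₅ : ψX (p.1, p.2, decide (∃ x, Sum.inr x ∈ A)) ∪ Sum.inl '' (Sum.inl ⁻¹' A)
        = A ∪ Sum.inl '' ψ p := by
      ext (z | z)
      · have : Sum.inl z ∈ ψX (p.1, p.2, decide (∃ x, Sum.inr x ∈ A)) ↔ z ∈ ψ p := by
          rw [← hψX, Set.mem_preimage]
        simp only [Set.mem_union, this, Set.mem_image, Sum.inl.injEq, exists_eq_right,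
          Set.mem_preimage]
        tauto
      · have : (∃ x : X, Sum.inr x ∈ A) ↔ Sum.inr z ∈ A :=
          ⟨fun ⟨x, hx⟩ => Subsingleton.elim x z ▸ hx, fun h => ⟨z, h⟩⟩
        simp [ψX, this]
    rw [← h₃, ← h₅, h₄]
    rfl

open Classical in
/-- If the subset `{a, b}` of `{a, b, c}` and the element `c` both have full rank, then the
polymatroid is 1-sticky. -/
theorem isSticky_one_of_rank_eq {M : Type u} [Finite M] {a b c : M} (hab : a ≠ b)
    (hM : (Set.univ : Set M) = {a, b, c}) (f : Polymatroid M)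
    (hab_rank : f.rank {a, b} = f.rank Set.univ) (hc_rank : f.rank {c} = f.rank Set.univ) :
    IsSticky.{u, v, w} f 1 := by
  intro X Y _ _ hcX hcY fX fY hfX hfY
  have : Subsingleton X := (Finite.card_le_one_iff_subsingleton).1 hcX
  have : Subsingleton Y := (Finite.card_le_one_iff_subsingleton).1 hcY
  obtain ⟨hX, hX_bot, hX_mono, hX_sub, hX_f, hX_rank⟩ :=
    hfX.exists_bool hab hM hab_rank hc_rank
  obtain ⟨hY, -, hY_mono, hY_sub, hY_f, hY_rank⟩ := hfY.exists_bool hab hM hab_rank hc_rank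
  obtain ⟨h, h_mono, h_sub, hhX, hhY⟩ := exists_amalgam_bool hX hY hX_bot hX_mono hY_mono
    hX_sub hY_sub fun i j => by rw [hX_f, hY_f]
  refine ⟨ofLattice h ((hhX _ _ _).trans hX_bot) h_mono h_sub (fun A =>
    (decide (Sum.inl a ∈ A ∨ Sum.inl c ∈ A), decide (Sum.inl b ∈ A ∨ Sum.inl c ∈ A),
      decide (∃ x, Sum.inr (Sum.inl x) ∈ A), decide (∃ y, Sum.inr (Sum.inr y) ∈ A)))
    ?_ ?_, ?_, ?_⟩
  · simp
    rfl
  · intro A B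
    simp only [Prod.mk_sup_mk, Prod.mk.injEq, Bool.sup_eq_bor, ← Bool.decide_or, decide_eq_decide,
      Set.mem_union, exists_or]
    tauto
  · intro A
    simp only [ofLattice]
    rw [hX_rank, ← hhX]
    simp
  · intro A
    simp only [ofLattice]
    rw [hY_rank, ← hhY]
    simp

end Polymatroid

theorem mainTheorem10 {M : Type u} [Finite M] (a b c : M)
    (hab : a ≠ b) (hac : a ≠ c) (hbc : b ≠ c)
    (hM : (Set.univ : Set M) = {a, b, c})
    (f : Polymatroid M)
    (ha : f.condRank {a} {b, c} = 0)
    (hb : f.condRank {b} {a, c} = 0)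
    (hc : f.condRank {c} {a, b} = 0)
    (h : f.condInfo {a} {b} {c} = 0 ∨ f.condInfo {a} {c} {b} = 0 ∨ f.condInfo {b} {c} {a} = 0) :
    Polymatroid.IsSticky.{u, v, w} f 1 := by
  have hMb : (Set.univ : Set M) = {a, c, b} := by rw [hM, Set.pair_comm b c]
  have hMa : (Set.univ : Set M) = {b, c, a} := by
    rw [hM]
    ext m
    simp only [Set.mem_insert_iff, Set.mem_singleton_iff]
    tauto
  have ea : ({a} ∪ {b, c} : Set M) = Set.univ := by rw [hM]; rfl
  have eb : ({b} ∪ {a, c} : Set M) = Set.univ := by rw [hM]; exact Set.insert_comm _ _ _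
  have ec : ({c} ∪ {a, b} : Set M) = Set.univ := by rw [hMa, Set.union_comm]; ext m; simp; tauto
  have hbc_rank : f.rank {b, c} = f.rank Set.univ := by
    rw [Polymatroid.condRank, ea] at ha
    linarith
  have hac_rank : f.rank {a, c} = f.rank Set.univ := by
    rw [Polymatroid.condRank, eb] at hb
    linarith
  have hab_rank : f.rank {a, b} = f.rank Set.univ := by
    rw [Polymatroid.condRank, ec] at hc
    linarith
  -- As pairs have full rank, each case says that the conditioning element has full rank.
  rcases h with h | h | h
  · refine Polymatroid.isSticky_one_of_rank_eq hab hM f hab_rank ?_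
    have e : ({a} ∪ {b} ∪ {c} : Set M) = Set.univ := by rw [Set.union_assoc]; exact ea
    have e₁ : ({a} ∪ {c} : Set M) = {a, c} := rfl
    have e₂ : ({b} ∪ {c} : Set M) = {b, c} := rfl
    rw [Polymatroid.condInfo, e, e₁, e₂] at h
    linarith
  · refine Polymatroid.isSticky_one_of_rank_eq hac hMb f hac_rank ?_
    have e : ({a} ∪ {c} ∪ {b} : Set M) = Set.univ := by
      rw [Set.union_assoc, Set.union_comm {c}]; exact ea
    have e₁ : ({a} ∪ {b} : Set M) = {a, b} := rfl
    have e₂ : ({c} ∪ {b} : Set M) = {b, c} := Set.union_comm _ _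
    rw [Polymatroid.condInfo, e, e₁, e₂] at h
    linarith
  · refine Polymatroid.isSticky_one_of_rank_eq hbc hMa f hbc_rank ?_
    have e : ({b} ∪ {c} ∪ {a} : Set M) = Set.univ := by rw [Set.union_comm]; exact ea
    have e₁ : ({b} ∪ {a} : Set M) = {a, b} := Set.union_comm _ _
    have e₂ : ({c} ∪ {a} : Set M) = {a, c} := Set.union_comm _ _
    rw [Polymatroid.condInfo, e, e₁, e₂] at h
    linarith
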